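/- All spaces are assumed to be $T_1$. For a collection $\mathcal G$ of subsets of $X$ and $x\in X$ put $St(x,\mathcal G)=\bigcup\{G\in\mathcal G : x\in G\}$. A sequence $(B_n)_n$ of open sets containing $x$ is a base at $x$ if every neighbourhood of $x$ contains some $B_n$. A sequence $(\mathcal G_n)_n$ of open covers of a space $X$ is called - a development if, for every $x\in X$, $(St(x,\mathcal G_n))_n$ is a base at $x$; - a weak development if, for every $x\in X$ and all $(G_n)_n$ with $x\in G_n\in\mathcal G_n$ for every $n$, the sequence $\left(\bigcap_{k\le n}G_k\right)_n$ is a base at $x$; - a weakly $G_\delta^*$-diagonal sequence if, for every $x\in X$ and all $(G_n)_n$ with $x\in G_n\in\mathcal G_n$ for every $n$, $\bigcap_n\overline{\bigcap_{k\le n}G_k}=\{x\}$; - a weakly $w\Delta$-sequence if, for every $x\in X$, all $(G_n)_n$ with $x\in G_n\in\mathcal G_n$ for every $n$, and all $(x_n)_n$ with $x_n\in\bigcap_{k\le n}G_k$ for every $n$, the sequence $(x_n)_n$ has a cluster point in $X$. The space $X$ is developable, is weakly developable, has a weakly $G_\delta^*$-diagonal, or is a weakly $w\Delta$-space, if it has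 a sequence of open covers of the respective kind. It is submetacompact if for every open cover $\mathcal U$ of $X$ there is a sequence $(\mathcal V_n)_n$ of open covers of $X$, each refining $\mathcal U$, such that for every $x\in X$ there is an $n$ for which $x$ belongs to only finitely many members of $\mathcal V_n$. It is paracompact if every open cover of $X$ has a locally finite open refinement that covers $X$. **Theorem.** Let $X$ be a $T_1$ topological space. 1. $X$ is Hausdorff and weakly developable if and only if it is a weakly $w\Delta$-space and has a weakly $G_\delta^*$-diagonal. 2. $X$ is Hausdorff and developable if and only if it is a submetacompact weakly $w\Delta$-space and has a weakly $G_\delta^*$-diagonal. 3. $X$ is metrizable if and only if it is a paracompact weakly $w\Delta$-space and has a weakly $G_\delta^*$-diagonal. In particular, for a Hausdorff space $X$, the word "Hausdorff" may be omitted in (1) and (2). -/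

import Mathlib

open Set Filter Topology

namespace WeakDev

variable {X : Type*} [TopologicalSpace X]

/-- A collection of subsets of `X` is an open cover of `X`. -/
def IsOpenCover (𝒢 : Set (Set X)) : Prop :=
  (∀ G ∈ 𝒢, IsOpen G) ∧ ⋃₀ 𝒢 = univ

/-- A sequence of open covers of `X`. -/
def IsOpenCoverSeq (𝒢 : ℕ → Set (Set X)) : Prop :=
  ∀ n, IsOpenCover (𝒢 n)

/-- The star `St(x, 𝒢)`: the union of all members of `𝒢` that contain `x`. -/
def St (x : X) (𝒢 : Set (Set X)) : Set X :=
  ⋃₀ {G | G ∈ 𝒢 ∧ x ∈ G}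

/-- The sequence of sets `B` is a (local) base at `x`: its terms are open neighbourhoods of `x`
and every neighbourhood of `x` contains one of them. -/
def IsBaseAt (x : X) (B : ℕ → Set X) : Prop :=
  (∀ n, IsOpen (B n) ∧ x ∈ B n) ∧ ∀ U ∈ 𝓝 x, ∃ n, B n ⊆ U

/-- `G` selects, for every `n`, a member of `𝒢 n` that contains `x`. -/
def IsSelectionAt (𝒢 : ℕ → Set (Set X)) (x : X) (G : ℕ → Set X) : Prop :=
  ∀ n, G n ∈ 𝒢 n ∧ x ∈ G n

/-- The finite intersection `⋂_{k ≤ n} G_k`. -/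
def partialInter (G : ℕ → Set X) (n : ℕ) : Set X :=
  ⋂ k ≤ n, G k

/-- Developments. -/
def IsDevelopment (𝒢 : ℕ → Set (Set X)) : Prop :=
  IsOpenCoverSeq 𝒢 ∧ ∀ x : X, IsBaseAt x (fun n => St x (𝒢 n))

/-- Weak developments. -/
def IsWeakDevelopment (𝒢 : ℕ → Set (Set X)) : Prop :=
  IsOpenCoverSeq 𝒢 ∧
    ∀ (x : X) (G : ℕ → Set X), IsSelectionAt 𝒢 x G → IsBaseAt x (partialInter G)

/-- Weakly `G_δ^*`-diagonal sequences. -/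
def IsWeaklyGδStarDiagonalSeq (𝒢 : ℕ → Set (Set X)) : Prop :=
  IsOpenCoverSeq 𝒢 ∧
    ∀ (x : X) (G : ℕ → Set X), IsSelectionAt 𝒢 x G → ⋂ n, closure (partialInter G n) = {x}

/-- Weakly `wΔ`-sequences. A cluster point of a sequence is a point each of whose
neighbourhoods contains infinitely many terms. -/
def IsWeaklyWΔSeq (𝒢 : ℕ → Set (Set X)) : Prop :=
  IsOpenCoverSeq 𝒢 ∧
    ∀ (x : X) (G : ℕ → Set X), IsSelectionAt 𝒢 x G →
      ∀ u : ℕ → X, (∀ n, u n ∈ partialInter G n) → ∃ y : X, MapClusterPt y atTop u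

variable (X)

/-- Developable spaces. -/
def Developable : Prop := ∃ 𝒢 : ℕ → Set (Set X), IsDevelopment 𝒢

/-- Weakly developable spaces. -/
def WeaklyDevelopable : Prop := ∃ 𝒢 : ℕ → Set (Set X), IsWeakDevelopment 𝒢

/-- Spaces with a weakly `G_δ^*`-diagonal. -/
def HasWeaklyGδStarDiagonal : Prop := ∃ 𝒢 : ℕ → Set (Set X), IsWeaklyGδStarDiagonalSeq 𝒢

/-- Weakly `wΔ`-spaces. -/
def WeaklyWΔSpace : Prop := ∃ 𝒢 : ℕ → Set (Set X), IsWeaklyWΔSeq 𝒢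

/-- Submetacompact (also called `θ`-refinable) spaces: every open cover `𝒰` has a sequence of
open refinements `𝒱 n`, each covering `X`, such that every point lies in only finitely many
members of some `𝒱 n`. -/
def Submetacompact : Prop :=
  ∀ 𝒰 : Set (Set X), IsOpenCover 𝒰 →
    ∃ 𝒱 : ℕ → Set (Set X), IsOpenCoverSeq 𝒱 ∧ (∀ n, ∀ V ∈ 𝒱 n, ∃ U ∈ 𝒰, V ⊆ U) ∧
      ∀ x : X, ∃ n, {V | V ∈ 𝒱 n ∧ x ∈ V}.Finite

end WeakDev

/-!
Let `𝒢` be a weakly `wΔ`-sequence and `ℋ` a weakly `G_δ^*`-diagonal sequence. The covers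
`𝒢 n ⊓ ℋ n` of pairwise intersections inherit both properties, and a sequence of covers with both
is a weak development: if no `⋂_{k ≤ n} G_k` were inside an open `U ∋ x`, points chosen outside `U`
would cluster at some `y ∉ U` lying in every `closure (⋂_{k ≤ n} G_k)`, whereas these closures meet
only in `x`. The diagonal property alone separates points by open sets. This is
`IsWeaklyWΔSeq.isWeakDevelopment_meet` and `IsWeaklyGδStarDiagonalSeq.t2Space`.

In a submetacompact space a weak development yields a development
(`WeaklyDevelopable.developable`): refine every `𝒢 n` by covers `𝒱 n m`, enumerate all of these,
and intersect longer and longer initial segments of the enumeration. At a point `x` pick for each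
`n` an `m` with only finitely many members of `𝒱 n m` containing `x`. The selections from these
finite families form a compact space, so the weak development property holds uniformly over them,
which puts a star at `x` inside a given neighbourhood. Conversely a developable space is
submetacompact (`Developable.submetacompact`) by Bing's well-ordering argument, which produces a
σ-discrete closed refinement of each open cover.

For metrizability, open covers of a paracompact Hausdorff space have barycentric open refinements
(`exists_barycentric_refinement`). A development can therefore be replaced by one in which each
cover is a barycentric refinement of its predecessor; the relations "`x` and `y` lie in a common
member of the `n`-th cover" are then a countable base of a uniformity inducing the topology.
-/

namespace WeakDev

/-! ### Open covers and partial intersections -/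

variable {X : Type*}

theorem mem_partialInter {G : ℕ → Set X} {n : ℕ} {x : X} :
    x ∈ partialInter G n ↔ ∀ k ≤ n, x ∈ G k := by
  simp [partialInter]

theorem partialInter_antitone (G : ℕ → Set X) : Antitone (partialInter G) :=
  fun _ _ h _ hx => mem_partialInter.2 fun k hk => mem_partialInter.1 hx k (hk.trans h)

theorem IsSelectionAt.mem_partialInter {𝒢 : ℕ → Set (Set X)} {x : X} {G : ℕ → Set X}
    (h : IsSelectionAt 𝒢 x G) (n : ℕ) : x ∈ partialInter G n :=
  WeakDev.mem_partialInter.2 fun k _ => (h k).2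

theorem mem_St {x y : X} {𝒢 : Set (Set X)} : y ∈ St x 𝒢 ↔ ∃ G ∈ 𝒢, x ∈ G ∧ y ∈ G := by
  simp [St, and_assoc]

theorem subset_St {x : X} {𝒢 : Set (Set X)} {G : Set X} (hG : G ∈ 𝒢) (hx : x ∈ G) :
    G ⊆ St x 𝒢 :=
  fun _ hy => mem_St.2 ⟨G, hG, hx, hy⟩

/-- A compactness form of König's lemma: if from each of countably many finite families of sets one
set is selected, and the partial intersections of every selection are eventually inside `U`, then a
single stage works for all selections. -/
theorem exists_forall_partialInter_subset {𝒦 : ℕ → Set (Set X)}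
    (hfin : ∀ n, (𝒦 n).Finite) {U : Set X}
    (h : ∀ V : ℕ → Set X, (∀ n, V n ∈ 𝒦 n) → ∃ n, partialInter V n ⊆ U) :
    ∃ n, ∀ V : ℕ → Set X, (∀ n, V n ∈ 𝒦 n) → partialInter V n ⊆ U := by
  let _ : ∀ n, TopologicalSpace (𝒦 n) := fun _ => ⊥
  have _ : ∀ n, DiscreteTopology (𝒦 n) := fun _ => ⟨rfl⟩
  have _ : ∀ n, Finite (𝒦 n) := fun n => hfin n
  let O : ℕ → Set (∀ n, 𝒦 n) := fun n => {f | partialInter (fun k => (f k : Set X)) n ⊆ U}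
  have hO : ∀ n, IsOpen (O n) := fun n => by
    -- membership in `O n` depends only on the finitely many coordinates `k ≤ n`
    have hcont : Continuous fun (f : ∀ n, 𝒦 n) (k : Iic n) => f k := by fun_prop
    have hpre := (isOpen_discrete
      {g : ∀ k : Iic n, 𝒦 k | (⋂ k, (g k : Set X)) ⊆ U}).preimage hcont
    convert hpre using 1
    ext f
    simp [O, partialInter, iInter_subtype]
  obtain ⟨n, hn⟩ := isCompact_univ.elim_directed_cover O hO
    (fun f _ => mem_iUnion.2 (h (fun k => f k) fun k => (f k).2))
    (directed_of_isDirected_le fun m n hmn f hf =>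
      (partialInter_antitone (fun k => (f k : Set X)) hmn).trans hf)
  exact ⟨n, fun V hV => hn (mem_univ fun k => (⟨V k, hV k⟩ : 𝒦 k))⟩

variable [TopologicalSpace X]

theorem IsOpenCover.exists_mem {𝒢 : Set (Set X)} (h : IsOpenCover 𝒢) (x : X) :
    ∃ G ∈ 𝒢, x ∈ G :=
  mem_sUnion.1 (h.2 ▸ mem_univ x)

theorem isOpenCover_of_exists {𝒢 : Set (Set X)} (ho : ∀ G ∈ 𝒢, IsOpen G)
    (hc : ∀ x, ∃ G ∈ 𝒢, x ∈ G) : IsOpenCover 𝒢 :=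
  ⟨ho, eq_univ_of_forall fun x => mem_sUnion.2 (hc x)⟩

theorem IsOpenCoverSeq.exists_selection {𝒢 : ℕ → Set (Set X)} (h : IsOpenCoverSeq 𝒢) (x : X) :
    ∃ G, IsSelectionAt 𝒢 x G := by
  choose G hG using fun n => (h n).exists_mem x
  exact ⟨G, hG⟩

theorem isOpen_partialInter {G : ℕ → Set X} (h : ∀ n, IsOpen (G n)) (n : ℕ) :
    IsOpen (partialInter G n) :=
  (finite_le_nat n).isOpen_biInter fun k _ => h k

theorem IsSelectionAt.isOpen_partialInter {𝒢 : ℕ → Set (Set X)} {x : X} {G : ℕ → Set X}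
    (h𝒢 : IsOpenCoverSeq 𝒢) (h : IsSelectionAt 𝒢 x G) (n : ℕ) : IsOpen (partialInter G n) :=
  WeakDev.isOpen_partialInter (fun n => (h𝒢 n).1 _ (h n).1) n

theorem IsOpenCover.isOpen_St {𝒢 : Set (Set X)} (h : IsOpenCover 𝒢) (x : X) :
    IsOpen (St x 𝒢) :=
  isOpen_sUnion fun G hG => h.1 G hG.1

theorem IsOpenCover.mem_St_self {𝒢 : Set (Set X)} (h : IsOpenCover 𝒢) (x : X) : x ∈ St x 𝒢 :=
  let ⟨G, hG, hx⟩ := h.exists_mem x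
  mem_St.2 ⟨G, hG, hx, hx⟩

/-- The common refinement of two covers, consisting of all intersections of a member of the first
with a member of the second. -/
def meet (𝒢 ℋ : Set (Set X)) : Set (Set X) := image2 (· ∩ ·) 𝒢 ℋ

theorem IsOpenCover.meet {𝒢 ℋ : Set (Set X)} (h𝒢 : IsOpenCover 𝒢) (hℋ : IsOpenCover ℋ) :
    IsOpenCover (meet 𝒢 ℋ) := by
  refine isOpenCover_of_exists ?_ fun x => ?_
  · rintro _ ⟨G, hG, H, hH, rfl⟩
    exact (h𝒢.1 G hG).inter (hℋ.1 H hH)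
  · obtain ⟨G, hG, hxG⟩ := h𝒢.exists_mem x
    obtain ⟨H, hH, hxH⟩ := hℋ.exists_mem x
    exact ⟨_, ⟨G, hG, H, hH, rfl⟩, hxG, hxH⟩

/-! ### Weak developments -/

theorem IsWeakDevelopment.isWeaklyWΔSeq {𝒢 : ℕ → Set (Set X)} (h : IsWeakDevelopment 𝒢) :
    IsWeaklyWΔSeq 𝒢 := by
  refine ⟨h.1, fun x G hG u hu => ⟨x, Tendsto.mapClusterPt ?_⟩⟩
  refine tendsto_def.2 fun U hU => ?_
  obtain ⟨n, hn⟩ := (h.2 x G hG).2 U hU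
  filter_upwards [eventually_ge_atTop n] with m hm
  exact hn (partialInter_antitone G hm (hu m))

theorem IsWeakDevelopment.isWeaklyGδStarDiagonalSeq [T2Space X] {𝒢 : ℕ → Set (Set X)}
    (h : IsWeakDevelopment 𝒢) : IsWeaklyGδStarDiagonalSeq 𝒢 := by
  refine ⟨h.1, fun x G hG => Subset.antisymm (fun y hy => ?_) ?_⟩
  · by_contra hne
    obtain ⟨U, V, hU, hV, hyU, hxV, hUV⟩ := t2_separation hne
    obtain ⟨n, hn⟩ := (h.2 x G hG).2 V (hV.mem_nhds hxV)
    obtain ⟨z, hzU, hz⟩ := mem_closure_iff.1 (mem_iInter.1 hy n) U hU hyU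
    exact hUV.le_bot ⟨hzU, hn hz⟩
  · exact singleton_subset_iff.2 (mem_iInter.2 fun n => subset_closure (hG.mem_partialInter n))

theorem IsWeaklyGδStarDiagonalSeq.t2Space {𝒢 : ℕ → Set (Set X)}
    (h : IsWeaklyGδStarDiagonalSeq 𝒢) : T2Space X := by
  refine ⟨fun x y hxy => ?_⟩
  obtain ⟨G, hG⟩ := h.1.exists_selection x
  have hy : y ∉ ⋂ n, closure (partialInter G n) := by
    rw [h.2 x G hG]
    exact fun e => hxy (mem_singleton_iff.1 e).symm
  rw [mem_iInter, not_forall] at hy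
  obtain ⟨n, hn⟩ := hy
  exact ⟨_, _, hG.isOpen_partialInter h.1 n, isClosed_closure.isOpen_compl,
    hG.mem_partialInter n, hn, disjoint_compl_right.mono_left subset_closure⟩

theorem IsWeaklyWΔSeq.isWeakDevelopment_meet {𝒢 ℋ : ℕ → Set (Set X)} (h𝒢 : IsWeaklyWΔSeq 𝒢)
    (hℋ : IsWeaklyGδStarDiagonalSeq ℋ) : IsWeakDevelopment fun n => meet (𝒢 n) (ℋ n) := by
  have hc : IsOpenCoverSeq fun n => meet (𝒢 n) (ℋ n) := fun n => (h𝒢.1 n).meet (hℋ.1 n)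
  refine ⟨hc, fun x K hK =>
    ⟨fun n => ⟨hK.isOpen_partialInter hc n, hK.mem_partialInter n⟩, fun U hU => ?_⟩⟩
  choose G hG H hH hGH using fun n => (hK n).1
  have hKG : ∀ n, K n ⊆ G n := fun n => hGH n ▸ inter_subset_left
  have hKH : ∀ n, K n ⊆ H n := fun n => hGH n ▸ inter_subset_right
  by_contra hcon
  simp only [not_exists, not_subset] at hcon
  choose u huK huU using hcon
  obtain ⟨y, hy⟩ := h𝒢.2 x G (fun n => ⟨hG n, hKG n (hK n).2⟩) u
    fun n => iInter₂_mono (fun k _ => hKG k) (huK n)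
  have hyx : y ∈ ⋂ n, closure (partialInter H n) := by
    refine mem_iInter.2 fun n => mem_closure_iff_nhds.2 fun V hV => ?_
    obtain ⟨m, hmV, hm⟩ :=
      ((mapClusterPt_iff_frequently.1 hy V hV).and_eventually (eventually_ge_atTop n)).exists
    exact ⟨u m, hmV, partialInter_antitone H hm (iInter₂_mono (fun k _ => hKH k) (huK m))⟩
  rw [hℋ.2 x H fun n => ⟨hH n, hKH n (hK n).2⟩, mem_singleton_iff] at hyx
  subst hyx
  obtain ⟨m, hm⟩ := (mapClusterPt_iff_frequently.1 hy U hU).exists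
  exact huU m hm

theorem t2Space_and_weaklyDevelopable_iff :
    (T2Space X ∧ WeaklyDevelopable X) ↔ (WeaklyWΔSpace X ∧ HasWeaklyGδStarDiagonal X) := by
  constructor
  · rintro ⟨_, 𝒢, h⟩
    exact ⟨⟨𝒢, h.isWeaklyWΔSeq⟩, ⟨𝒢, h.isWeaklyGδStarDiagonalSeq⟩⟩
  · rintro ⟨⟨𝒢, h𝒢⟩, ⟨ℋ, hℋ⟩⟩
    exact ⟨hℋ.t2Space, _, h𝒢.isWeakDevelopment_meet hℋ⟩

theorem Developable.weaklyDevelopable (h : Developable X) : WeaklyDevelopable X := by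
  obtain ⟨𝒢, hc, h⟩ := h
  refine ⟨𝒢, hc, fun x G hG =>
    ⟨fun n => ⟨hG.isOpen_partialInter hc n, hG.mem_partialInter n⟩, fun U hU => ?_⟩⟩
  obtain ⟨n, hn⟩ := (h x).2 U hU
  exact ⟨n, fun y hy => hn (subset_St (hG n).1 (hG n).2 (mem_partialInter.1 hy n le_rfl))⟩

/-! ### Developability and submetacompactness -/

/-- The closed sets `F α` below form a discrete family: every member of the `n`-th cover of the
development meets at most one of them. So removing from each member `α` of `𝒰` all `F β` with
`β ≠ α` leaves an open cover, and each point of `⋃ α, F α` lies in just one of its members. The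
point `x` lies in `F α` for the least `α` containing `x` as soon as `St x (𝒢 n) ⊆ α`. -/
theorem Developable.submetacompact (h : Developable X) : Submetacompact X := by
  obtain ⟨𝒢, hc, h⟩ := h
  intro 𝒰 h𝒰
  let r : Set X → Set X → Prop := WellOrderingRel
  let F : ℕ → Set X → Set X := fun n α => {x | St x (𝒢 n) ⊆ α ∧ ∀ β ∈ 𝒰, r β α → x ∉ β}
  have hF : ∀ n, ∀ G ∈ 𝒢 n, ∀ α ∈ 𝒰, ∀ β ∈ 𝒰, (G ∩ F n α).Nonempty → (G ∩ F n β).Nonempty →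
      α = β := by
    rintro n G hG α hα β hβ ⟨y, hyG, hyα, hyα'⟩ ⟨z, hzG, hzβ, hzβ'⟩
    rcases trichotomous_of r α β with hlt | heq | hgt
    · exact (hzβ' α hα hlt (hyα (mem_St.2 ⟨G, hG, hyG, hzG⟩))).elim
    · exact heq
    · exact (hyα' β hβ hgt (hzβ (mem_St.2 ⟨G, hG, hzG, hyG⟩))).elim
  have hFα : ∀ n α, F n α ⊆ α := fun n α x hx => hx.1 ((hc n).mem_St_self x)
  have hFc : ∀ n, ∀ α ∈ 𝒰, IsClosed (F n α) := fun n α hα => by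
    refine isClosed_of_closure_subset fun x hx => ⟨fun y hy => ?_, fun β hβ hβα hxβ => ?_⟩
    · obtain ⟨G, hG, hxG, hyG⟩ := mem_St.1 hy
      obtain ⟨z, hzG, hz⟩ := mem_closure_iff.1 hx G ((hc n).1 G hG) hxG
      exact hz.1 (mem_St.2 ⟨G, hG, hzG, hyG⟩)
    · obtain ⟨z, hzβ, hz⟩ := mem_closure_iff.1 hx β (h𝒰.1 β hβ) hxβ
      exact hz.2 β hβ hβα hzβ
  let V : ℕ → Set X → Set X := fun n α => {x | x ∈ α ∧ ∀ β ∈ 𝒰, β ≠ α → x ∉ F n β}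
  have hVo : ∀ n, ∀ α ∈ 𝒰, IsOpen (V n α) := fun n α hα => by
    refine isOpen_iff_mem_nhds.2 fun x hx => ?_
    obtain ⟨G, hG, hxG⟩ := (hc n).exists_mem x
    have hGn : G ∩ α ∈ 𝓝 x :=
      inter_mem (((hc n).1 G hG).mem_nhds hxG) ((h𝒰.1 α hα).mem_nhds hx.1)
    by_cases hex : ∃ β ∈ 𝒰, β ≠ α ∧ (G ∩ F n β).Nonempty
    · obtain ⟨β, hβ, hβα, hGβ⟩ := hex
      filter_upwards [hGn, (hFc n β hβ).isOpen_compl.mem_nhds (hx.2 β hβ hβα)] with z hz hzβ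
      refine ⟨hz.2, fun γ hγ _ hzγ => hzβ ?_⟩
      rwa [hF n G hG β hβ γ hγ hGβ ⟨z, hz.1, hzγ⟩]
    · filter_upwards [hGn] with z hz
      exact ⟨hz.2, fun γ hγ hγα hzγ => hex ⟨γ, hγ, hγα, z, hz.1, hzγ⟩⟩
  refine ⟨fun n => V n '' 𝒰, fun n => isOpenCover_of_exists ?_ fun x => ?_, fun n => ?_,
    fun x => ?_⟩
  · rintro _ ⟨α, hα, rfl⟩
    exact hVo n α hα
  · by_cases hx : ∃ α ∈ 𝒰, x ∈ F n α
    · obtain ⟨α, hα, hxα⟩ := hx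
      obtain ⟨G, hG, hxG⟩ := (hc n).exists_mem x
      exact ⟨_, ⟨α, hα, rfl⟩, hFα n α hxα, fun β hβ hβα hxβ =>
        hβα (hF n G hG β hβ α hα ⟨x, hxG, hxβ⟩ ⟨x, hxG, hxα⟩)⟩
    · obtain ⟨α, hα, hxα⟩ := h𝒰.exists_mem x
      exact ⟨_, ⟨α, hα, rfl⟩, hxα, fun β hβ _ hxβ => hx ⟨β, hβ, hxβ⟩⟩
  · rintro _ ⟨α, hα, rfl⟩
    exact ⟨α, hα, fun x hx => hx.1⟩
  · have hwf : WellFounded r := IsWellFounded.wf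
    obtain ⟨α, ⟨hα, hxα⟩, hmin⟩ := hwf.has_min {α | α ∈ 𝒰 ∧ x ∈ α} (h𝒰.exists_mem x)
    obtain ⟨n, hn⟩ := (h x).2 α ((h𝒰.1 α hα).mem_nhds hxα)
    have hxF : x ∈ F n α := ⟨hn, fun β hβ hβα hxβ => hmin β ⟨hβ, hxβ⟩ hβα⟩
    refine ⟨n, (finite_singleton (V n α)).subset ?_⟩
    rintro _ ⟨⟨β, hβ, rfl⟩, hxβ⟩
    by_contra hne
    exact hxβ.2 α hα (fun e => hne (e ▸ rfl)) hxF

theorem WeaklyDevelopable.developable (h : WeaklyDevelopable X) (hX : Submetacompact X) :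
    Developable X := by
  obtain ⟨𝒢, hc, h⟩ := h
  choose 𝒱 h𝒱c h𝒱ref h𝒱fin using fun n => hX (𝒢 n) (hc n)
  let 𝒜 : ℕ → Set (Set X) := fun i => 𝒱 i.unpair.1 i.unpair.2
  have h𝒜 : IsOpenCoverSeq 𝒜 := fun i => h𝒱c _ _
  let 𝒲 : ℕ → Set (Set X) := fun N => {W | ∃ A : ℕ → Set X, (∀ i, A i ∈ 𝒜 i) ∧
    W = partialInter A N}
  have h𝒲 : IsOpenCoverSeq 𝒲 := fun N => by
    refine isOpenCover_of_exists ?_ fun x => ?_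
    · rintro _ ⟨A, hA, rfl⟩
      exact isOpen_partialInter (fun i => (h𝒜 i).1 _ (hA i)) N
    · obtain ⟨A, hA⟩ := h𝒜.exists_selection x
      exact ⟨_, ⟨A, fun i => (hA i).1, rfl⟩, hA.mem_partialInter N⟩
  refine ⟨𝒲, h𝒲, fun x =>
    ⟨fun n => ⟨(h𝒲 n).isOpen_St x, (h𝒲 n).mem_St_self x⟩, fun U hU => ?_⟩⟩
  choose m hm using fun n => h𝒱fin n x
  obtain ⟨n, hn⟩ := exists_forall_partialInter_subset (U := U) hm fun V hV => by
    choose G hG hVG using fun k => h𝒱ref k (m k) (V k) (hV k).1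
    obtain ⟨n, hn⟩ := (h x G fun k => ⟨hG k, hVG k (hV k).2⟩).2 U hU
    exact ⟨n, (iInter₂_mono fun k _ => hVG k).trans hn⟩
  -- the `N`-th initial segment of the enumeration contains `𝒱 k (m k)` for all `k ≤ n`
  obtain ⟨N, hN⟩ : ∃ N, ∀ k ≤ n, Nat.pair k (m k) ≤ N :=
    ⟨(Finset.range (n + 1)).sup fun k => Nat.pair k (m k), fun k hk =>
      Finset.le_sup (f := fun k => Nat.pair k (m k)) (Finset.mem_range.2 (by omega))⟩
  refine ⟨N, fun y hy => ?_⟩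
  obtain ⟨_, ⟨A, hA, rfl⟩, hxA, hyA⟩ := mem_St.1 hy
  rw [mem_partialInter] at hxA hyA
  -- past `n`, where `A` need not contain `x`, any selection at `x` will do
  choose B hB using fun k => (h𝒱c k (m k)).exists_mem x
  let V : ℕ → Set X := fun k => if k ≤ n then A (Nat.pair k (m k)) else B k
  refine hn V (fun k => ?_) (mem_partialInter.2 fun k hk => ?_)
  · by_cases hk : k ≤ n
    · have := hA (Nat.pair k (m k))
      simp only [𝒜, Nat.unpair_pair] at this
      simpa [V, hk] using ⟨this, hxA _ (hN k hk)⟩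
    · simpa [V, hk] using hB k
  · simpa [V, hk] using hyA _ (hN k hk)

/-! ### Paracompactness and metrizability -/

theorem submetacompact_of_paracompactSpace [ParacompactSpace X] : Submetacompact X := by
  intro 𝒰 h𝒰
  obtain ⟨v, hvo, hvc, hvf, hvs⟩ := precise_refinement (fun U : 𝒰 => (U : Set X))
    (fun U => h𝒰.1 U U.2) (by rw [← sUnion_eq_iUnion, h𝒰.2])
  refine ⟨fun _ => range v, fun _ => ⟨?_, by rw [sUnion_range, hvc]⟩, fun _ => ?_, fun x => ⟨0, ?_⟩⟩
  · rintro _ ⟨i, rfl⟩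
    exact hvo i
  · rintro _ ⟨i, rfl⟩
    exact ⟨i, i.2, hvs i⟩
  · refine ((hvf.point_finite x).image v).subset ?_
    rintro _ ⟨⟨i, rfl⟩, hi⟩
    exact ⟨i, hi, rfl⟩

/-- Barycentric means that the star of every point is inside some member of `𝒰`. The refinement is
built from a locally finite refinement `v` and a closed shrinking `F` of it. -/
theorem exists_barycentric_refinement [T2Space X] [ParacompactSpace X] {𝒰 : Set (Set X)}
    (h𝒰 : IsOpenCover 𝒰) :
    ∃ 𝒲 : Set (Set X), IsOpenCover 𝒲 ∧ ∀ y, ∃ U ∈ 𝒰, St y 𝒲 ⊆ U := by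
  obtain ⟨v, hvo, hvc, hvf, hvs⟩ := precise_refinement (fun U : 𝒰 => (U : Set X))
    (fun U => h𝒰.1 U U.2) (by rw [← sUnion_eq_iUnion, h𝒰.2])
  obtain ⟨w, hwc, -, hwv⟩ := exists_iUnion_eq_closure_subset hvo hvf.point_finite hvc
  let F : 𝒰 → Set X := fun i => closure (w i)
  have hF : LocallyFinite F := hvf.subset hwv
  -- near `x`, stay inside every `v i` with `x ∈ F i` and avoid every other `F i`
  let W : X → Set X := fun x => (⋂ i ∈ {i | x ∈ F i}, v i) ∩ (⋃ i : {i // x ∉ F i}, F i)ᶜ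
  refine ⟨range W, isOpenCover_of_exists ?_ fun x => ⟨_, ⟨x, rfl⟩, ?_⟩, fun y => ?_⟩
  · rintro _ ⟨x, rfl⟩
    refine ((hF.point_finite x).isOpen_biInter fun i _ => hvo i).inter ?_
    exact ((hF.comp_injective Subtype.val_injective).isClosed_iUnion
      fun _ => isClosed_closure).isOpen_compl
  · refine ⟨mem_iInter₂.2 fun i hi => hwv i hi, fun hx => ?_⟩
    obtain ⟨i, hi⟩ := mem_iUnion.1 hx
    exact i.2 hi
  · obtain ⟨i, hi⟩ := mem_iUnion.1 (hwc ▸ mem_univ y)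
    refine ⟨i, i.2, fun z hz => ?_⟩
    obtain ⟨_, ⟨x, rfl⟩, hy, hz⟩ := mem_St.1 hz
    have hxi : x ∈ F i := by
      by_contra hxi
      exact hy.2 (mem_iUnion.2 ⟨⟨i, hxi⟩, subset_closure hi⟩)
    exact hvs i (mem_iInter₂.1 hz.1 i hxi)

/-- A development in which every cover is a barycentric refinement of its predecessor induces a
countably generated uniformity compatible with the topology. -/
theorem metrizableSpace_of_barycentric_development [T0Space X] {𝒲 : ℕ → Set (Set X)}
    (h𝒲 : IsDevelopment 𝒲) (hb : ∀ n y, ∃ W ∈ 𝒲 n, St y (𝒲 (n + 1)) ⊆ W) :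
    TopologicalSpace.MetrizableSpace X := by
  let D : ℕ → Set (X × X) := fun n => {p | p.2 ∈ St p.1 (𝒲 n)}
  have hrefl : ∀ n x, (x, x) ∈ D n := fun n x => (h𝒲.1 n).mem_St_self x
  have hsymm : ∀ n x y, (x, y) ∈ D n → (y, x) ∈ D n := fun n x y hxy => by
    obtain ⟨W, hW, hx, hy⟩ := mem_St.1 hxy
    exact mem_St.2 ⟨W, hW, hy, hx⟩
  have hcomp : ∀ n x y z, (x, y) ∈ D (n + 1) → (y, z) ∈ D (n + 1) → (x, z) ∈ D n :=
    fun n x y z hxy hyz => by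
      obtain ⟨W, hW, hs⟩ := hb n y
      exact mem_St.2 ⟨W, hW, hs (hsymm _ _ _ hxy), hs hyz⟩
  have hanti : Antitone D := antitone_nat_of_succ_le fun n p hp =>
    hcomp n p.1 p.1 p.2 (hrefl _ _) hp
  have hbasis : (⨅ n, 𝓟 (D n)).HasBasis (fun _ => True) D :=
    hasBasis_iInf_principal hanti.directed_ge
  let _ : UniformSpace X :=
    { toTopologicalSpace := ‹_›
      uniformity := ⨅ n, 𝓟 (D n)
      symm := (hbasis.tendsto_iff hbasis).2 fun n _ => ⟨n, trivial, fun p hp => hsymm n _ _ hp⟩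
      comp := by
        refine ((hbasis.lift' (monotone_id.relComp monotone_id)).le_basis_iff hbasis).2
          fun n _ => ⟨n + 1, trivial, ?_⟩
        rintro ⟨x, z⟩ ⟨y, hxy, hyz⟩
        exact hcomp n x y z hxy hyz
      nhds_eq_comap_uniformity := fun x => by
        refine HasBasis.eq_of_same_basis (p := fun _ : ℕ => True)
          (s := fun n => St x (𝒲 n)) ⟨fun U => ?_⟩ (hbasis.comap (Prod.mk x))
        refine ⟨fun hU => ?_, ?_⟩
        · obtain ⟨n, hn⟩ := (h𝒲.2 x).2 U hU
          exact ⟨n, trivial, hn⟩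
        · rintro ⟨n, -, hn⟩
          exact mem_of_superset (((h𝒲.2 x).1 n).1.mem_nhds ((h𝒲.2 x).1 n).2) hn }
  have : (uniformity X).IsCountablyGenerated := hbasis.isCountablyGenerated
  exact UniformSpace.metrizableSpace

theorem Developable.metrizableSpace [T2Space X] [ParacompactSpace X] (h : Developable X) :
    TopologicalSpace.MetrizableSpace X := by
  obtain ⟨𝒢, hc, h⟩ := h
  choose b hbc hb using fun 𝒰 : {𝒰 : Set (Set X) // IsOpenCover 𝒰} =>
    exists_barycentric_refinement 𝒰.2
  -- meeting with `𝒢 n` before refining keeps the new sequence a development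
  let 𝒲 : ℕ → {𝒰 : Set (Set X) // IsOpenCover 𝒰} := fun n => Nat.rec ⟨𝒢 0, hc 0⟩
    (fun n 𝒰 => ⟨b ⟨meet 𝒰.1 (𝒢 n), 𝒰.2.meet (hc n)⟩, hbc _⟩) n
  have hstep : ∀ n y, ∃ U ∈ meet (𝒲 n).1 (𝒢 n), St y (𝒲 (n + 1)).1 ⊆ U :=
    fun n y => hb ⟨meet (𝒲 n).1 (𝒢 n), (𝒲 n).2.meet (hc n)⟩ y
  refine metrizableSpace_of_barycentric_development (𝒲 := fun n => (𝒲 n).1)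
    ⟨fun n => (𝒲 n).2, fun x => ⟨fun n => ⟨(𝒲 n).2.isOpen_St x, (𝒲 n).2.mem_St_self x⟩,
      fun U hU => ?_⟩⟩ fun n y => ?_
  · obtain ⟨n, hn⟩ := (h x).2 U hU
    obtain ⟨_, ⟨A, hA, B, hB, rfl⟩, hs⟩ := hstep n x
    exact ⟨n + 1, (hs.trans inter_subset_right).trans
      ((subset_St hB (hs ((𝒲 (n + 1)).2.mem_St_self x)).2).trans hn)⟩
  · obtain ⟨_, ⟨A, hA, B, hB, rfl⟩, hs⟩ := hstep n y
    exact ⟨A, hA, hs.trans inter_subset_left⟩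

theorem weaklyDevelopable_of_metrizableSpace [TopologicalSpace.MetrizableSpace X] :
    WeaklyDevelopable X := by
  let _ := TopologicalSpace.metrizableSpaceMetric X
  let 𝒢 : ℕ → Set (Set X) := fun n => range fun x => Metric.ball x (1 / (n + 1 : ℝ))
  have hc : IsOpenCoverSeq 𝒢 := fun n => isOpenCover_of_exists
    (by rintro _ ⟨x, rfl⟩; exact Metric.isOpen_ball)
    fun x => ⟨_, ⟨x, rfl⟩, Metric.mem_ball_self Nat.one_div_pos_of_nat⟩
  refine Developable.weaklyDevelopable ⟨𝒢, hc, fun x =>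
    ⟨fun n => ⟨(hc n).isOpen_St x, (hc n).mem_St_self x⟩, fun U hU => ?_⟩⟩
  obtain ⟨ε, hε, hεU⟩ := Metric.mem_nhds_iff.1 hU
  obtain ⟨n, hn⟩ := exists_nat_one_div_lt (half_pos hε)
  refine ⟨n, fun y hy => hεU ?_⟩
  obtain ⟨_, ⟨z, rfl⟩, hx, hy⟩ := mem_St.1 hy
  rw [Metric.mem_ball] at hx hy ⊢
  linarith [dist_triangle_right y x z]

end WeakDev

open WeakDev in
theorem mainTheorem3 (X : Type*) [TopologicalSpace X] [T1Space X] :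
    ((T2Space X ∧ WeakDev.WeaklyDevelopable X) ↔
      (WeakDev.WeaklyWΔSpace X ∧ WeakDev.HasWeaklyGδStarDiagonal X)) ∧
    ((T2Space X ∧ WeakDev.Developable X) ↔
      (WeakDev.Submetacompact X ∧ WeakDev.WeaklyWΔSpace X ∧
        WeakDev.HasWeaklyGδStarDiagonal X)) ∧
    (TopologicalSpace.MetrizableSpace X ↔
      (ParacompactSpace X ∧ WeakDev.WeaklyWΔSpace X ∧ WeakDev.HasWeaklyGδStarDiagonal X)) := by
  refine ⟨t2Space_and_weaklyDevelopable_iff, ⟨?_, ?_⟩, ⟨fun _ => ?_, ?_⟩⟩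
  · rintro ⟨h2, h⟩
    exact ⟨h.submetacompact, t2Space_and_weaklyDevelopable_iff.1 ⟨h2, h.weaklyDevelopable⟩⟩
  · rintro ⟨hs, h⟩
    obtain ⟨h2, hw⟩ := t2Space_and_weaklyDevelopable_iff.2 h
    exact ⟨h2, hw.developable hs⟩
  · refine ⟨?_, t2Space_and_weaklyDevelopable_iff.1
      ⟨inferInstance, weaklyDevelopable_of_metrizableSpace⟩⟩
    let _ := TopologicalSpace.metrizableSpaceMetric X
    infer_instance
  · rintro ⟨_, h⟩
    obtain ⟨_, hw⟩ := t2Space_and_weaklyDevelopable_iff.2 h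
    exact (hw.developable submetacompact_of_paracompactSpace).metrizableSpace
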